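/- Let $H_3(\mathbb R)$ be the group of real $3\times 3$ upper triangular matrices with ones on the diagonal, let $\mathfrak h_3(\mathbb R)$ be its Lie algebra of strictly upper triangular matrices, with matrix exponential $\exp$, let $P(\mathfrak h_3(\mathbb R))$ be the set of lines (1-dimensional subspaces) of $\mathfrak h_3(\mathbb R)$, and let $\Gamma=H_3(\mathbb Z)$ be the lattice of matrices with integer entries in $H_3(\mathbb R)$. For a measure preserving action $T=(T_\gamma)_{\gamma\in\Gamma}$ on a $\sigma$-finite standard measure space $(X,\mu)$ and a right-invariant metric $\mathrm{dist}$ on $H_3(\mathbb R)$ compatible with the topology, $T$ is recurrent along a line $\theta\in P(\mathfrak h_3(\mathbb R))$ if for every $\epsilon>0$ and every measurable $A\subset X$ with $\mu(A)>0$ there are $\gamma\in\Gamma\setminus\{1\}$ and $g\in\exp(\theta)$ with $\mathrm{dist}(\gamma,g)<\epsilon$ and $\mu(A\cap T_\gamma A)>0$; $\mathcal R(T)$ denotes the set of all such $\theta$. The action $T$ is of rank one if there are a Følner sequence $(F_n)$ of nonempty finite subsets of $\Gamma$ (that is, $\#(\gamma F_n\triangle F_n)/\#F_n\to0$ for every $\gamma\in\Gamma$)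 and measurable sets $B_n\subset X$ of finite measure such that for each $n$ the sets $T_fB_n$, $f\in F_n$, are pairwise disjoint, and for every measurable $A$ of finite measure there are $S_n\subset F_n$ with $\mu\bigl(A\triangle\bigcup_{f\in S_n}T_fB_n\bigr)\to 0$. **Theorem 6.1.** There is a free rank-one measure preserving action $T$ of $H_3(\mathbb Z)$ on a nonatomic $\sigma$-finite standard measure space $(X,\mu)$ with $\mu(X)=\infty$ such that $\mathcal R(T)=\emptyset$ (for every right-invariant metric on $H_3(\mathbb R)$ compatible with the topology). -/

import Mathlib

open scoped Pointwise

noncomputable section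

/-- The real Heisenberg group `H₃(ℝ)`: upper triangular `3 × 3` real matrices with ones on the
diagonal, as a subgroup of `SL₃(ℝ)`, with the subspace topology. -/
def heisenbergGroup : Subgroup (Matrix.SpecialLinearGroup (Fin 3) ℝ) where
  carrier := {g | (∀ i, g i i = 1) ∧ ∀ i j, j < i → g i j = 0}
  one_mem' := by
    refine ⟨fun i => by simp, fun i j hij => ?_⟩
    simp [Matrix.one_apply_ne (ne_of_gt hij)]
  mul_mem' := by
    rintro g h ⟨hg, hg'⟩ ⟨hh, hh'⟩
    have e1 := hg' 1 0 (by decide)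
    have e2 := hg' 2 0 (by decide)
    have e3 := hg' 2 1 (by decide)
    have f1 := hh' 1 0 (by decide)
    have f2 := hh' 2 0 (by decide)
    have f3 := hh' 2 1 (by decide)
    refine ⟨fun i => ?_, fun i j hij => ?_⟩
    · fin_cases i <;>
        simp [Matrix.SpecialLinearGroup.coe_mul, Matrix.mul_apply, Fin.sum_univ_three, hg, hh,
          e1, e2, e3, f1, f2, f3]
    · fin_cases i <;> fin_cases j <;> first
        | exact absurd hij (by decide)
        | simp [Matrix.SpecialLinearGroup.coe_mul, Matrix.mul_apply, Fin.sum_univ_three, hg, hh,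
            e1, e2, e3, f1, f2, f3]
  inv_mem' := by
    rintro g ⟨hg, hg'⟩
    have e1 := hg' 1 0 (by decide)
    have e2 := hg' 2 0 (by decide)
    have e3 := hg' 2 1 (by decide)
    refine ⟨fun i => ?_, fun i j hij => ?_⟩
    · fin_cases i <;>
        simp [Matrix.SpecialLinearGroup.coe_inv, Matrix.adjugate_fin_three, hg, e1, e2, e3]
    · fin_cases i <;> fin_cases j <;> first
        | exact absurd hij (by decide)
        | simp [Matrix.SpecialLinearGroup.coe_inv, Matrix.adjugate_fin_three, hg, e1, e2, e3]

/-- The underlying `3 × 3` matrix of an element of `H₃(ℝ)`. -/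
def heisenbergMatrix (g : heisenbergGroup) : Matrix (Fin 3) (Fin 3) ℝ :=
  ((g : Matrix.SpecialLinearGroup (Fin 3) ℝ) : Matrix (Fin 3) (Fin 3) ℝ)

/-- The lattice `H₃(ℤ)` in `H₃(ℝ)`: the elements all of whose entries are integers. -/
def heisenbergLattice : Subgroup heisenbergGroup where
  carrier := {g | ∀ i j, ∃ n : ℤ, heisenbergMatrix g i j = n}
  one_mem' := fun i j => ⟨(1 : Matrix (Fin 3) (Fin 3) ℤ) i j, by
    simp [heisenbergMatrix, Matrix.one_apply]⟩
  mul_mem' := by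
    intro g h hg hh i j
    choose a ha using hg
    choose b hb using hh
    exact ⟨∑ k, a i k * b k j, by
      simp only [heisenbergMatrix] at ha hb ⊢
      simp [Matrix.SpecialLinearGroup.coe_mul, Matrix.mul_apply, ha, hb]⟩
  inv_mem' := by
    intro g hg i j
    choose a ha using hg
    refine ⟨(Matrix.of a).adjugate i j, ?_⟩
    have h : heisenbergMatrix g = (Matrix.of a).map (Int.castRingHom ℝ) := by
      ext i j
      simp [ha]
    have h2 : heisenbergMatrix g⁻¹ = (heisenbergMatrix g).adjugate := by
      simp [heisenbergMatrix, Matrix.SpecialLinearGroup.coe_inv]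
    rw [h2, h, ← RingHom.mapMatrix_apply, ← RingHom.map_adjugate]
    rfl

/-- The (vector space underlying the) Lie algebra `𝔥₃(ℝ)` of `H₃(ℝ)`: strictly upper triangular
`3 × 3` real matrices. -/
def heisenbergLie : Submodule ℝ (Matrix (Fin 3) (Fin 3) ℝ) where
  carrier := {v | ∀ i j, j ≤ i → v i j = 0}
  zero_mem' := fun _ _ _ => rfl
  add_mem' := by
    intro v w hv hw i j hij
    simp [hv i j hij, hw i j hij]
  smul_mem' := by
    intro c v hv i j hij
    simp [hv i j hij]

/-- The one-parameter subgroup `exp(θ)` of `H₃(ℝ)` attached to a line `θ` in `𝔥₃(ℝ)`, where `exp`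
is the matrix exponential. -/
def expLine (θ : Projectivization ℝ heisenbergLie) : Set heisenbergGroup :=
  {g | ∃ v ∈ θ.submodule,
    heisenbergMatrix g = NormedSpace.exp (v : Matrix (Fin 3) (Fin 3) ℝ)}

/-- The metric `m` on the topological group `G` is right-invariant and induces the topology
of `G`. -/
def IsRightInvariantCompatible {G : Type*} [Group G] [t : TopologicalSpace G]
    (m : MetricSpace G) : Prop :=
  m.toPseudoMetricSpace.toUniformSpace.toTopologicalSpace = t ∧
    ∀ a b c : G, m.dist (a * c) (b * c) = m.dist a b

/-- The set `𝓡(T)` of recurrent directions of an action of `H₃(ℤ)` on `(X, μ)`, computed with the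
metric `m` on `H₃(ℝ)`. -/
def recurrentDirections (m : MetricSpace heisenbergGroup) {X : Type*} [MeasurableSpace X]
    [MulAction heisenbergLattice X] (μ : MeasureTheory.Measure X) :
    Set (Projectivization ℝ heisenbergLie) :=
  {θ | ∀ ε : ℝ, 0 < ε → ∀ A : Set X, MeasurableSet A → 0 < μ A →
    ∃ γ : heisenbergLattice, γ ≠ 1 ∧ (∃ g ∈ expLine θ, m.dist (γ : heisenbergGroup) g < ε) ∧
      0 < μ (A ∩ γ • A)}

/-- A (left) Følner sequence of nonempty finite subsets of a discrete group. -/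
def IsFolnerSeq {Γ : Type*} [Group Γ] (F : ℕ → Finset Γ) : Prop :=
  (∀ n, (F n).Nonempty) ∧
    ∀ γ : Γ, Filter.Tendsto
      (fun n => (Set.ncard (symmDiff (γ • (F n : Set Γ)) (F n : Set Γ)) : ℝ) / ((F n).card : ℝ))
      Filter.atTop (nhds 0)

/-- Rank one: there are Rokhlin towers with bases `B n`, whose shapes `F n` form a Følner sequence,
such that every measurable set of finite measure is asymptotically approximated by unions of
levels of the towers. -/
def IsRankOne (Γ : Type*) [Group Γ] {X : Type*} [MeasurableSpace X] [MulAction Γ X]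
    (μ : MeasureTheory.Measure X) : Prop :=
  ∃ F : ℕ → Finset Γ, IsFolnerSeq F ∧ ∃ B : ℕ → Set X,
    (∀ n, MeasurableSet (B n) ∧ μ (B n) < ⊤) ∧
    (∀ n, ∀ f ∈ F n, ∀ f' ∈ F n, f ≠ f' → Disjoint (f • B n) (f' • B n)) ∧
    ∀ A : Set X, MeasurableSet A → μ A < ⊤ →
      ∃ S : ℕ → Finset Γ, (∀ n, S n ⊆ F n) ∧
        Filter.Tendsto (fun n => μ (symmDiff A (⋃ f ∈ S n, f • B n))) Filter.atTop (nhds 0)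

end

/-
The action is built by cutting and stacking with the spacers `s k = (8 ^ k, 2 ^ k, 0)`. A finite
0-1 sequence codes the product of the `s k` over its digits `1`, and the space is the product of
`{0, 1}^ℕ` and `H₃(ℤ)`, each change of finitely many digits being absorbed into the `H₃(ℤ)`
coordinate through these products; `H₃(ℤ)` acts on the left.

The base of the `n`-th tower consists of the points with the first `n` digits zero. If a nontrivial
`γ = (a, b, c)` returns part of it to itself, two sequences of digits that agree below `n` have
products differing by `γ`. If `k` is the top digit at which they differ, then `8 ^ k` dominates
`1 + 8 + ⋯ + 8 ^ (k - 1)`, so `6 (8 ^ k - 1) / 7 < |a|` and `1 ≤ |b| < 2 ^ (k + 1)`. Hence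
`n |b| ≤ |a|`, whereas near a line `exp θ` either `|b| < 1` or `|a| / |b|` is bounded: no line is a
direction of recurrence.

Boxes in which two values of `a` differ by less than that gap therefore have disjoint translates of
the base. They can be chosen to form a Følner sequence that swallows the levels of the earlier
towers, so the action has rank one. As `b` never vanishes for a return, the translates of the first
base by central elements are disjoint, and the measure is infinite.
-/

namespace CuttingStacking

noncomputable section

open MeasureTheory Set Filter Topology MulAction
open scoped symmDiff

section OrbitQuotient

variable {G H α : Type*} [Group G] [Group H] [MulAction G α] [MulAction H α]

instance [SMulCommClass G H α] : MulAction G (orbitRel.Quotient H α) where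
  smul g := Quotient.map' (g • ·) fun _ _ ⟨h, hab⟩ => ⟨h, by
    simp only [← hab, smul_comm g h]⟩
  one_smul := Quotient.ind' fun a => congrArg Quotient.mk'' (one_smul G a)
  mul_smul g g' := Quotient.ind' fun a => congrArg Quotient.mk'' (mul_smul g g' a)

theorem smul_mk [SMulCommClass G H α] (g : G) (a : α) :
    g • (Quotient.mk (orbitRel H α) a) = Quotient.mk (orbitRel H α) (g • a) := rfl

variable [MeasurableSpace α]

instance [SMulCommClass G H α] [MeasurableConstSMul G α] :
    MeasurableConstSMul G (orbitRel.Quotient H α) where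
  measurable_const_smul g :=
    measurable_from_quotient.2 (measurable_quotient_mk''.comp (measurable_const_smul g))

theorem measurableSet_mk_image [Countable H] [MeasurableConstSMul H α] {E : Set α}
    (hE : MeasurableSet E) : MeasurableSet (Quotient.mk (orbitRel H α) '' E) := by
  have hpre : Quotient.mk (orbitRel H α) ⁻¹' (Quotient.mk (orbitRel H α) '' E) = _ :=
    quotient_preimage_image_eq_union_mul E
  rw [measurableSet_quotient, Quotient.mk''_eq_mk, hpre]
  exact .iUnion fun h => hE.const_smul h

theorem standardBorelSpace_of_measurableEquiv {X Y : Type*} [MeasurableSpace X]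
    [MeasurableSpace Y] [StandardBorelSpace Y] (e : X ≃ᵐ Y) : StandardBorelSpace X := by
  let _ := upgradeStandardBorel Y
  let _ : TopologicalSpace X := .induced e inferInstance
  refine ⟨_, ⟨?_⟩, e.toEquiv.polishSpace_induced⟩
  rw [← e.measurableEmbedding.comap_eq]
  exact (congrArg _ (eq_borel_upgradeStandardBorel Y)).trans borel_comap.symm

theorem standardBorelSpace_orbitQuotient [Countable H] [MeasurableConstSMul H α]
    [StandardBorelSpace α] {D : Set α} (hD : MeasurableSet D)
    (hD' : ∀ x, ∃! h : H, h • x ∈ D) : StandardBorelSpace (orbitRel.Quotient H α) := by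
  have := hD.standardBorel
  have hbij : Function.Bijective fun x : D => Quotient.mk (orbitRel H α) x := by
    refine ⟨fun x y hxy => Subtype.ext ?_, Quotient.ind fun x => ?_⟩
    · obtain ⟨h, hh : h • y.1 = x⟩ := Quotient.exact hxy
      have h_one : h = 1 := (hD' y).unique (by simp [hh]) (by simp)
      rw [← hh, h_one, one_smul]
    · obtain ⟨h, hh, -⟩ := hD' x
      exact ⟨⟨h • x, hh⟩, Quotient.sound ⟨h, rfl⟩⟩
  refine standardBorelSpace_of_measurableEquiv (Y := D)
    { (Equiv.ofBijective _ hbij).symm with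
      measurable_toFun := fun s hs => ?_
      measurable_invFun := measurable_quotient_mk''.comp measurable_subtype_coe }
  change MeasurableSet ((Equiv.ofBijective _ hbij).symm ⁻¹' s)
  rw [← Equiv.image_eq_preimage_symm]
  convert! measurableSet_mk_image (H := H) (hD.subtype_image hs) using 1
  rw [image_image]
  rfl

variable (H) in
/-- The points at which `f` takes the smallest value on their `H`-orbit. If `f` is injective on
orbits these form a fundamental domain. -/
def orbitMinimizers (f : α → ℕ) : Set α := {x | ∀ h : H, f x ≤ f (h • x)}

theorem measurableSet_orbitMinimizers [Countable H] [MeasurableConstSMul H α] {f : α → ℕ}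
    (hf : Measurable f) : MeasurableSet (orbitMinimizers H f) := by
  simp only [orbitMinimizers, ofPred_forall]
  exact .iInter fun h => measurableSet_le hf (hf.comp (measurable_const_smul h))

omit [MeasurableSpace α] in
theorem existsUnique_smul_mem_orbitMinimizers {f : α → ℕ}
    (hf : ∀ (h : H) x, f (h • x) = f x → h = 1) (x : α) :
    ∃! h : H, h • x ∈ orbitMinimizers H f := by
  have hmin (k : H) : k • x ∈ orbitMinimizers H f ↔ ∀ h : H, f (k • x) ≤ f (h • x) := by
    refine ⟨fun hk h => ?_, fun hk h => by simpa only [smul_smul] using hk (h * k)⟩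
    simpa only [smul_smul, inv_mul_cancel_right] using hk (h * k⁻¹)
  let k := Function.argmin fun h : H => f (h • x)
  have hk (h : H) : f (k • x) ≤ f (h • x) := Function.argmin_le (fun h : H => f (h • x)) h
  refine ⟨k, (hmin k).2 hk, fun h hh => ?_⟩
  refine mul_inv_eq_one.1 (hf _ (k • x) ?_)
  rw [smul_smul, inv_mul_cancel_right]
  exact le_antisymm ((hmin h).1 hh k) (hk h)

variable {ν : Measure α} (μ : Measure (orbitRel.Quotient H α))
  [QuotientMeasureEqMeasurePreimage ν μ]

theorem smulInvariantMeasure_of_quotient [HasFundamentalDomain H α ν] [SMulCommClass G H α]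
    [MeasurableConstSMul G α] [SMulInvariantMeasure G α ν] : SMulInvariantMeasure G _ μ where
  measure_preimage_smul g U hU := by
    obtain ⟨D, hD⟩ := ‹HasFundamentalDomain H α ν›
    rw [hD.projection_respects_measure_apply μ (measurable_const_smul g hU),
      (hD.smul_of_comm g).projection_respects_measure_apply μ hU,
      ← measure_preimage_smul ν g (_ ∩ g • D), preimage_inter,
      preimage_smul g (g • D),
      inv_smul_smul]
    rfl

variable [Countable H] [MeasurableConstSMul H α] [SMulInvariantMeasure H α ν]

theorem measure_mk_image_le [HasFundamentalDomain H α ν] {E : Set α} (hE : MeasurableSet E) :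
    μ (Quotient.mk (orbitRel H α) '' E) ≤ ν E := by
  obtain ⟨D, hD⟩ := ‹HasFundamentalDomain H α ν›
  have hpre : Quotient.mk (orbitRel H α) ⁻¹' (Quotient.mk (orbitRel H α) '' E) = _ :=
    quotient_preimage_image_eq_union_mul E
  rw [hD.projection_respects_measure_apply μ (measurableSet_mk_image hE), hpre, iUnion_inter,
    hD.measure_eq_tsum E]
  exact measure_iUnion_le _

theorem measure_eq_zero_of_mk_image [HasFundamentalDomain H α ν] {E : Set α}
    (hE : MeasurableSet E) (h : μ (Quotient.mk (orbitRel H α) '' E) = 0) : ν E = 0 := by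
  obtain ⟨D, hD⟩ := ‹HasFundamentalDomain H α ν›
  rw [hD.projection_respects_measure_apply μ (measurableSet_mk_image hE)] at h
  refine measure_mono_null (subset_preimage_image _ E)
    (hD.measure_zero_of_invariant _ (fun k => ?_) h)
  ext x
  rw [mem_smul_set_iff_inv_smul_mem, mem_preimage, mem_preimage,
    show Quotient.mk (orbitRel H α) (k⁻¹ • x) = Quotient.mk _ x from Quotient.sound ⟨k⁻¹, rfl⟩]

theorem nullSingletonClass_of_quotient [HasFundamentalDomain H α ν] [MeasurableSingletonClass α]
    [NullSingletonClass ν] : NullSingletonClass μ where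
  measure_singleton := Quotient.ind fun a => by
    rw [← image_singleton, ← nonpos_iff_eq_zero, ← measure_singleton (μ := ν) a]
    exact measure_mk_image_le μ (measurableSet_singleton a)

end OrbitQuotient

section Approximation

variable {X : Type*} [MeasurableSpace X] {μ : Measure X} {L : ℕ → Set (Set X)} {A A' : Set X}

variable (μ L) in
/-- `A` is asymptotically approximated in measure by members of the families `L n`. With `L n` the
unions of levels of the `n`-th tower, this is the approximation property in the definition of
rank one. -/
def IsApproximable (A : Set X) : Prop :=
  ∀ ε : ENNReal, 0 < ε → ∀ᶠ n in atTop, ∃ E ∈ L n, μ (A ∆ E) ≤ ε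

theorem isApproximable_of_eventually_mem (h : ∀ᶠ n in atTop, A ∈ L n) : IsApproximable μ L A :=
  fun _ _ => h.mono fun n hn => ⟨A, hn, by simp⟩

theorem isApproximable_of_approx
    (h : ∀ ε : ENNReal, 0 < ε → ∃ A', IsApproximable μ L A' ∧ μ (A ∆ A') ≤ ε) :
    IsApproximable μ L A := fun ε hε => by
  obtain ⟨A', hA', hle⟩ := h (ε / 2) (ENNReal.half_pos hε.ne')
  filter_upwards [hA' (ε / 2) (ENNReal.half_pos hε.ne')] with n ⟨E, hE, hE'⟩
  refine ⟨E, hE, ?_⟩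
  calc μ (A ∆ E) ≤ μ (A ∆ A') + μ (A' ∆ E) := measure_symmDiff_le A A' E
    _ ≤ ε / 2 + ε / 2 := add_le_add hle hE'
    _ = ε := ENNReal.add_halves ε

theorem IsApproximable.union (hL : ∀ n, SupClosed (L n)) (hA : IsApproximable μ L A)
    (hA' : IsApproximable μ L A') : IsApproximable μ L (A ∪ A') := fun ε hε => by
  filter_upwards [hA (ε / 2) (ENNReal.half_pos hε.ne'), hA' (ε / 2) (ENNReal.half_pos hε.ne')]
    with n ⟨E, hE, hle⟩ ⟨E', hE', hle'⟩
  refine ⟨E ∪ E', hL n hE hE', ?_⟩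
  calc μ ((A ∪ A') ∆ (E ∪ E')) ≤ μ (A ∆ E ∪ A' ∆ E') :=
        measure_mono union_symmDiff_union_subset
    _ ≤ μ (A ∆ E) + μ (A' ∆ E') := measure_union_le _ _
    _ ≤ ε / 2 + ε / 2 := add_le_add hle hle'
    _ = ε := ENNReal.add_halves ε

theorem IsApproximable.biUnion (hL : ∀ n, SupClosed (L n)) (h_empty : ∀ n, ∅ ∈ L n)
    {ι : Type*} {A : ι → Set X} (hA : ∀ i, IsApproximable μ L (A i)) (s : Finset ι) :
    IsApproximable μ L (⋃ i ∈ s, A i) := by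
  classical
  induction s using Finset.induction_on with
  | empty => simpa using isApproximable_of_eventually_mem (.of_forall h_empty)
  | insert i s _ ih => simpa using (hA i).union hL ih

theorem IsApproximable.iUnion (hL : ∀ n, SupClosed (L n)) (h_empty : ∀ n, ∅ ∈ L n)
    {ι : Type*} [Countable ι] {A : ι → Set X} (hA : ∀ i, IsApproximable μ L (A i))
    (hm : ∀ i, MeasurableSet (A i)) (hfin : μ (⋃ i, A i) ≠ ⊤) :
    IsApproximable μ L (⋃ i, A i) := by
  refine isApproximable_of_approx fun ε hε => ?_
  have htail : Tendsto (fun s : Finset ι => μ ((⋃ i, A i) \ ⋃ i ∈ s, A i)) atTop (𝓝 0) := by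
    have h := tendsto_measure_iInter_atTop (μ := μ)
      (s := fun s : Finset ι => (⋃ i, A i) \ ⋃ i ∈ s, A i)
      (fun s => ((MeasurableSet.iUnion hm).diff
        (s.measurableSet_biUnion fun i _ => hm i)).nullMeasurableSet)
      (fun s t hst => sdiff_subset_sdiff_right (biUnion_subset_biUnion_left hst))
      ⟨∅, by simpa using hfin⟩
    rwa [← sdiff_iUnion, ← iUnion_eq_iUnion_finset, sdiff_self, measure_empty] at h
  obtain ⟨s, hs⟩ := (ENNReal.tendsto_nhds_zero.1 htail ε hε).exists
  refine ⟨⋃ i ∈ s, A i, .biUnion hL h_empty hA s, ?_⟩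
  rwa [Set.symmDiff_def, sdiff_eq_empty.2 (iUnion₂_subset_iUnion _ _), union_empty]

variable {Γ : Type*} [Group Γ] [MulAction Γ X] {F : ℕ → Finset Γ} {B : ℕ → Set X}

variable (F B) in
/-- The unions of levels of the tower with shape `F n` and base `B n`. -/
def levelUnions (n : ℕ) : Set (Set X) := {E | ∃ S ⊆ F n, E = ⋃ f ∈ S, f • B n}

omit [MeasurableSpace X] in
theorem supClosed_levelUnions (n : ℕ) : SupClosed (levelUnions F B n) := by
  classical
  rintro _ ⟨S, hS, rfl⟩ _ ⟨S', hS', rfl⟩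
  exact ⟨S ∪ S', Finset.union_subset hS hS', by exact (Finset.set_biUnion_union S S' _).symm⟩

omit [MeasurableSpace X] in
theorem empty_mem_levelUnions (n : ℕ) : ∅ ∈ levelUnions F B n := ⟨∅, by simp, by simp⟩

theorem exists_tendsto_of_isApproximable (hA : IsApproximable μ (levelUnions F B) A) :
    ∃ S : ℕ → Finset Γ, (∀ n, S n ⊆ F n) ∧
      Tendsto (fun n => μ (A ∆ ⋃ f ∈ S n, f • B n)) atTop (𝓝 0) := by
  choose S hS hmin using fun n => Finset.exists_min_image (F n).powerset
    (fun S => μ (A ∆ ⋃ f ∈ S, f • B n)) ⟨∅, by simp⟩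
  refine ⟨S, fun n => Finset.mem_powerset.1 (hS n), ENNReal.tendsto_nhds_zero.2 fun ε hε => ?_⟩
  filter_upwards [hA ε hε] with n ⟨_, ⟨T, hT, rfl⟩, hle⟩
  exact (hmin n T (Finset.mem_powerset.2 hT)).trans hle

end Approximation

section Tower

variable {Γ : Type*} [Group Γ]

/-- The partial products `c₀ ^ y₀ ⋯ cₙ₋₁ ^ yₙ₋₁` selected by a binary sequence `y`. -/
def word (c : ℕ → Γ) (y : ℕ → ZMod 2) : ℕ → Γ
  | 0 => 1
  | n + 1 => word c y n * c n ^ (y n).val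

theorem word_congr (c : ℕ → Γ) {y z : ℕ → ZMod 2} {n : ℕ} (h : ∀ i < n, y i = z i) :
    word c y n = word c z n := by
  induction n with
  | zero => rfl
  | succ n ih => rw [word, word, ih fun i hi => h i (by lia), h n n.lt_succ_self]

theorem word_zero (c : ℕ → Γ) (n : ℕ) : word c 0 n = 1 := by
  induction n with
  | zero => rfl
  | succ n ih => simp [word, ih]

theorem word_mul_word_inv_of_le (c : ℕ → Γ) {y z : ℕ → ZMod 2} {n m : ℕ}
    (h : ∀ i ≥ n, y i = z i) (hnm : n ≤ m) :
    word c y m * (word c z m)⁻¹ = word c y n * (word c z n)⁻¹ := by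
  induction m, hnm using Nat.le_induction with
  | base => rfl
  | succ m hm ih => rw [← ih, word, word, h m hm]; group

/-- The words selected by binary sequences determine their digits. Then the second coordinate is
injective on the `TailGroup`-orbits in `SkewProduct c`, whence a measurable fundamental domain. -/
class UniquelyDecodable (c : ℕ → Γ) : Prop where
  eq_of_word_eq : ∀ {y z : ℕ → ZMod 2} {n : ℕ}, word c y n = word c z n → ∀ i < n, y i = z i

/-- The group of finitely supported binary sequences, written multiplicatively. -/
abbrev TailGroup : Type := Multiplicative (ℕ →₀ ZMod 2)

instance : Countable TailGroup := inferInstanceAs (Countable (ℕ →₀ ZMod 2))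

/-- A length beyond which all the digits of `s` vanish. -/
def TailGroup.length (s : TailGroup) : ℕ := s.toAdd.support.sup id + 1

theorem TailGroup.eq_zero_of_length_le {s : TailGroup} {i : ℕ} (hi : s.length ≤ i) :
    s.toAdd i = 0 :=
  Finsupp.notMem_support_iff.1 fun h => (Finset.le_sup (f := id) h).not_gt hi

/-- The cocycle of the translation action of `TailGroup` on binary sequences which compares the
words selected before and after the translation. -/
def cocycle (c : ℕ → Γ) (s : TailGroup) (y : ℕ → ZMod 2) : Γ :=
  word c y s.length * (word c (⇑s.toAdd + y) s.length)⁻¹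

theorem cocycle_eq (c : ℕ → Γ) {s : TailGroup} (y : ℕ → ZMod 2) {n : ℕ}
    (hn : ∀ i ≥ n, s.toAdd i = 0) :
    cocycle c s y = word c y n * (word c (⇑s.toAdd + y) n)⁻¹ := by
  have h_eq {k : ℕ} (hk : ∀ i ≥ k, s.toAdd i = 0) : ∀ i ≥ k, y i = (⇑s.toAdd + y) i :=
    fun i hi => by simp [hk i hi]
  rw [← word_mul_word_inv_of_le c (h_eq hn) (le_max_left n s.length), cocycle,
    word_mul_word_inv_of_le c (h_eq fun _ => TailGroup.eq_zero_of_length_le)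
      (le_max_right n s.length)]

theorem cocycle_one (c : ℕ → Γ) (y : ℕ → ZMod 2) : cocycle c 1 y = 1 :=
  (cocycle_eq c (s := 1) y (n := 0) (by simp)).trans (mul_inv_cancel 1)

theorem cocycle_mul (c : ℕ → Γ) (s t : TailGroup) (y : ℕ → ZMod 2) :
    cocycle c (s * t) y = cocycle c t y * cocycle c s (⇑t.toAdd + y) := by
  have hs (i) (hi : i ≥ max s.length t.length) : s.toAdd i = 0 :=
    TailGroup.eq_zero_of_length_le (le_of_max_le_left hi)
  have ht (i) (hi : i ≥ max s.length t.length) : t.toAdd i = 0 :=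
    TailGroup.eq_zero_of_length_le (le_of_max_le_right hi)
  rw [cocycle_eq c _ hs, cocycle_eq c _ ht,
    cocycle_eq c (s := s * t) y (n := max s.length t.length) fun i hi => by simp [hs i hi, ht i hi],
    toAdd_mul, Finsupp.coe_add, add_assoc]
  group

/-- The space of pairs of a binary sequence and a group element, on which `TailGroup` acts through
`cocycle c` and `Γ` acts by left translation of the second coordinate. -/
def SkewProduct (_ : ℕ → Γ) : Type _ := (ℕ → ZMod 2) × Γ

variable (c : ℕ → Γ)

/-- The set `K × {g}`. -/
def slice (K : Set (ℕ → ZMod 2)) (g : Γ) : Set (SkewProduct c) := K ×ˢ {g}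

instance : MulAction TailGroup (SkewProduct c) where
  smul s p := (⇑s.toAdd + p.1, p.2 * cocycle c s p.1)
  one_smul p := Prod.ext (zero_add p.1) (by
    change p.2 * cocycle c 1 p.1 = p.2
    rw [cocycle_one, mul_one])
  mul_smul s t p := Prod.ext (add_assoc _ _ p.1) (by
    change p.2 * cocycle c (s * t) p.1 = p.2 * cocycle c t p.1 * cocycle c s (⇑t.toAdd + p.1)
    rw [cocycle_mul, mul_assoc])

instance : MulAction Γ (SkewProduct c) where
  smul γ p := (p.1, γ * p.2)
  one_smul p := Prod.ext rfl (one_mul p.2)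
  mul_smul γ δ p := Prod.ext rfl (mul_assoc γ δ p.2)

instance : SMulCommClass Γ TailGroup (SkewProduct c) where
  smul_comm γ s p := Prod.ext rfl (mul_assoc γ p.2 (cocycle c s p.1)).symm

variable {c}

theorem mem_orbit_iff {p q : SkewProduct c} : p ∈ orbit TailGroup q ↔
    ∃ n, (∀ i ≥ n, p.1 i = q.1 i) ∧ p.2 * word c p.1 n = q.2 * word c q.1 n := by
  constructor
  · rintro ⟨s, rfl⟩
    refine ⟨s.length, fun i hi => ?_, ?_⟩
    · change s.toAdd i + q.1 i = q.1 i
      rw [TailGroup.eq_zero_of_length_le hi, zero_add]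
    · change q.2 * cocycle c s q.1 * word c (⇑s.toAdd + q.1) s.length = _
      rw [cocycle]
      group
  · rintro ⟨n, h, hw⟩
    have hfin : (Function.support (p.1 - q.1)).Finite :=
      (finite_lt_nat n).subset fun i hi => lt_of_not_ge fun hni => hi (sub_eq_zero.2 (h i hni))
    let s : TailGroup := .ofAdd (Finsupp.ofSupportFinite _ hfin)
    have hs : ⇑s.toAdd + q.1 = p.1 := sub_add_cancel p.1 q.1
    refine ⟨s, Prod.ext hs ?_⟩
    change q.2 * cocycle c s q.1 = p.2
    rw [cocycle_eq c q.1 (n := n) fun i hi => sub_eq_zero.2 (h i hi), hs, ← mul_assoc, ← hw,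
      mul_inv_cancel_right]

theorem eq_one_of_smul_snd_eq [UniquelyDecodable c] {s : TailGroup} {p : SkewProduct c}
    (h : (s • p).2 = p.2) : s = 1 := by
  have hw : word c p.1 s.length = word c (⇑s.toAdd + p.1) s.length :=
    mul_inv_eq_one.1 (mul_eq_left.1 h)
  refine Multiplicative.toAdd.injective (Finsupp.ext fun i => ?_)
  obtain hi | hi := lt_or_ge i s.length
  · exact right_eq_add.1 (UniquelyDecodable.eq_of_word_eq hw i hi)
  · exact TailGroup.eq_zero_of_length_le hi

end Tower

section SkewProductMeasure

theorem neBot_nhdsNE_zero_of_compactSpace (G : Type*) [AddGroup G] [TopologicalSpace G]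
    [ContinuousAdd G] [CompactSpace G] [Infinite G] : (𝓝[≠] (0 : G)).NeBot := by
  by_contra h
  have : DiscreteTopology G := discreteTopology_of_isOpen_singleton_zero
    ((isOpen_singleton_iff_punctured_nhds 0).2 (not_neBot.1 h))
  exact Infinite.not_finite (α := G) finite_of_compact_of_discrete

variable {Γ : Type*} [MeasurableSpace Γ] {c : ℕ → Γ}

instance : MeasurableSpace (SkewProduct c) := inferInstanceAs (MeasurableSpace ((ℕ → ZMod 2) × Γ))

variable [DiscreteMeasurableSpace Γ]

theorem measurableSet_slice {K : Set (ℕ → ZMod 2)} (hK : MeasurableSet K) (g : Γ) :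
    MeasurableSet (slice c K g) :=
  hK.prod (measurableSet_singleton g)

variable [Countable Γ]

instance : StandardBorelSpace (SkewProduct c) :=
  inferInstanceAs (StandardBorelSpace ((ℕ → ZMod 2) × Γ))

variable (c) in
/-- Haar measure on binary sequences times counting measure. -/
def skewMeasure : Measure (SkewProduct c) :=
  (Measure.addHaar (G := ℕ → ZMod 2)).prod Measure.count

instance : SigmaFinite (skewMeasure c) :=
  inferInstanceAs (SigmaFinite ((Measure.addHaar (G := ℕ → ZMod 2)).prod Measure.count))

theorem skewMeasure_slice (K : Set (ℕ → ZMod 2)) (g : Γ) :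
    skewMeasure c (slice c K g) = Measure.addHaar K :=
  (Measure.prod_prod K {g}).trans (by rw [Measure.count_singleton, mul_one])

instance : NullSingletonClass (skewMeasure c) where
  measure_singleton p := by
    have := neBot_nhdsNE_zero_of_compactSpace (ℕ → ZMod 2)
    rw [show {p} = slice c {p.1} p.2 from singleton_prod_singleton.symm, skewMeasure_slice,
      measure_singleton]

variable [Group Γ]

theorem measurable_word (n : ℕ) : Measurable fun y => word c y n := by
  induction n with
  | zero => exact measurable_const
  | succ n ih =>
    exact (Measurable.of_discrete (f := fun p : Γ × ZMod 2 => p.1 * c n ^ p.2.val)).comp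
      (ih.prodMk (measurable_pi_apply n))

theorem measurable_cocycle (s : TailGroup) : Measurable (cocycle c s) :=
  (Measurable.of_discrete (f := fun p : Γ × Γ => p.1 * p.2⁻¹)).comp
    ((measurable_word s.length).prodMk
      ((measurable_word s.length).comp (measurable_const_add _)))

theorem measurePreserving_tailGroup_smul (s : TailGroup) :
    MeasurePreserving (s • · : SkewProduct c → SkewProduct c) (skewMeasure c) (skewMeasure c) :=
  (measurePreserving_add_left Measure.addHaar ⇑s.toAdd).skew_product
    (g := fun y g => g * cocycle c s y)
    ((Measurable.of_discrete (f := fun p : Γ × Γ => p.1 * p.2)).comp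
      (measurable_snd.prodMk ((measurable_cocycle s).comp measurable_fst)))
    (.of_forall fun y => map_mul_right_eq_self Measure.count (cocycle c s y))

theorem measurePreserving_smul (γ : Γ) :
    MeasurePreserving (γ • · : SkewProduct c → SkewProduct c) (skewMeasure c) (skewMeasure c) :=
  (MeasurePreserving.id Measure.addHaar).prod (measurePreserving_mul_left Measure.count γ)

instance : MeasurableConstSMul TailGroup (SkewProduct c) :=
  ⟨fun s => (measurePreserving_tailGroup_smul s).measurable⟩

instance : SMulInvariantMeasure TailGroup (SkewProduct c) (skewMeasure c) :=
  ⟨fun s _ hE => (measurePreserving_tailGroup_smul s).measure_preimage hE.nullMeasurableSet⟩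

instance : MeasurableConstSMul Γ (SkewProduct c) :=
  ⟨fun γ => (measurePreserving_smul γ).measurable⟩

instance : SMulInvariantMeasure Γ (SkewProduct c) (skewMeasure c) :=
  ⟨fun γ _ hE => (measurePreserving_smul γ).measure_preimage hE.nullMeasurableSet⟩

end SkewProductMeasure

section CuttingAndStacking

variable {Γ : Type*} [Group Γ]

/-- The space of the cutting-and-stacking (that is, `(C, F)`-) action of `Γ` with spacers `c`. -/
abbrev CFSpace (c : ℕ → Γ) : Type _ := orbitRel.Quotient TailGroup (SkewProduct c)

variable (c : ℕ → Γ)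

/-- The image of `K × {g}` in `CFSpace c`. -/
def cfSlice (K : Set (ℕ → ZMod 2)) (g : Γ) : Set (CFSpace c) :=
  Quotient.mk (orbitRel TailGroup (SkewProduct c)) '' slice c K g

/-- The binary sequences whose first `n` terms vanish. -/
def zeros (n : ℕ) : Set (ℕ → ZMod 2) := {y | ∀ i < n, y i = 0}

theorem mem_zeros_zero (y : ℕ → ZMod 2) : y ∈ zeros 0 := fun i hi => absurd hi i.not_lt_zero

theorem isOpen_zeros (n : ℕ) : IsOpen (zeros n) :=
  isOpen_set_pi (finite_Iio n) fun _ _ => isOpen_discrete {(0 : ZMod 2)}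

/-- The base of the `n`-th tower. -/
def base (n : ℕ) : Set (CFSpace c) := cfSlice c (zeros n) 1

variable {c}

theorem mk_mem_cfSlice {K : Set (ℕ → ZMod 2)} {g : Γ} {p : SkewProduct c} :
    Quotient.mk (orbitRel TailGroup (SkewProduct c)) p ∈ cfSlice c K g ↔
      ∃ y ∈ K, ∃ n, (∀ i ≥ n, p.1 i = y i) ∧ p.2 * word c p.1 n = g * word c y n := by
  constructor
  · rintro ⟨⟨y, _⟩, ⟨hy, rfl⟩, h⟩
    exact ⟨y, hy, mem_orbit_iff.1 (Quotient.exact h.symm)⟩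
  · rintro ⟨y, hy, h⟩
    exact ⟨(y, g), ⟨hy, rfl⟩, (Quotient.sound (mem_orbit_iff.2 h)).symm⟩

theorem symmDiff_cfSlice_subset (K K' : Set (ℕ → ZMod 2)) (g : Γ) :
    cfSlice c K g ∆ cfSlice c K' g ⊆ cfSlice c (K ∆ K') g := by
  rintro _ (⟨⟨⟨y, _⟩, ⟨hy, rfl⟩, rfl⟩, hn⟩ | ⟨⟨⟨y, _⟩, ⟨hy, rfl⟩, rfl⟩, hn⟩)
  · exact ⟨_, ⟨.inl ⟨hy, fun h => hn ⟨_, ⟨h, rfl⟩, rfl⟩⟩, rfl⟩, rfl⟩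
  · exact ⟨_, ⟨.inr ⟨hy, fun h => hn ⟨_, ⟨h, rfl⟩, rfl⟩⟩, rfl⟩, rfl⟩

theorem eq_one_of_smul_eq {γ : Γ} {x : CFSpace c} (h : γ • x = x) : γ = 1 := by
  induction x using Quotient.ind with
  | _ p =>
    obtain ⟨n, -, hn⟩ := mem_orbit_iff.1 (Quotient.exact h)
    exact mul_eq_right.1 (mul_right_cancel hn)

theorem smul_cfSlice (γ g : Γ) (K : Set (ℕ → ZMod 2)) :
    γ • cfSlice c K g = cfSlice c K (γ * g) := by
  ext x
  induction x using Quotient.ind with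
  | _ p =>
    rw [mem_smul_set_iff_inv_smul_mem, smul_mk, mk_mem_cfSlice, mk_mem_cfSlice]
    change (∃ y ∈ K, ∃ n, _ ∧ γ⁻¹ * p.2 * word c p.1 n = g * word c y n) ↔ _
    simp only [mul_assoc, inv_mul_eq_iff_eq_mul]
    rfl

theorem smul_base (γ : Γ) (n : ℕ) : γ • base c n = cfSlice c (zeros n) γ := by
  rw [base, smul_cfSlice, mul_one]

theorem word_eq_one_of_mem_zeros {y : ℕ → ZMod 2} {n : ℕ} (hy : y ∈ zeros n) :
    word c y n = 1 :=
  (word_congr c hy).trans (word_zero c n)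

theorem exists_word_eq_of_mem_smul_base {γ δ : Γ} {n : ℕ} {x : CFSpace c} (h : x ∈ γ • base c n)
    (h' : x ∈ δ • base c n) :
    ∃ y ∈ zeros n, ∃ z ∈ zeros n, ∃ m, γ * word c y m = δ * word c z m := by
  rw [smul_base] at h h'
  obtain ⟨⟨z, _⟩, ⟨hz, rfl⟩, rfl⟩ := h'
  obtain ⟨y, hy, m, -, hm⟩ := mk_mem_cfSlice.1 h
  exact ⟨y, hy, z, hz, m, hm.symm⟩

theorem disjoint_smul_base {γ δ : Γ} {n : ℕ}
    (h : ∀ y ∈ zeros n, ∀ z ∈ zeros n, ∀ m, γ * word c y m ≠ δ * word c z m) :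
    Disjoint (γ • base c n) (δ • base c n) := by
  refine disjoint_left.2 fun x hx hx' => ?_
  obtain ⟨y, hy, z, hz, m, hm⟩ := exists_word_eq_of_mem_smul_base hx hx'
  exact h y hy z hz m hm

theorem cfSlice_eq_biUnion_smul_base {K : Set (ℕ → ZMod 2)} {n : ℕ}
    (hK : ∀ y z, (∀ i < n, y i = z i) → (y ∈ K ↔ z ∈ K)) (g : Γ) :
    cfSlice c K g = ⋃ y ∈ K, (g * word c y n) • base c n := by
  classical
  simp only [smul_base]
  refine Subset.antisymm ?_ (iUnion₂_subset fun y hy => ?_)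
  · rintro _ ⟨⟨y, _⟩, ⟨hy, rfl⟩, rfl⟩
    have hz : (Iio n).piecewise 0 y ∈ zeros n := fun i hi => piecewise_eq_of_mem _ _ _ hi
    refine mem_iUnion₂.2 ⟨y, hy, mk_mem_cfSlice.2 ⟨_, hz, n, fun i hi => ?_, ?_⟩⟩
    · exact (piecewise_eq_of_notMem (Iio n) _ _ (notMem_Iio.2 hi)).symm
    · rw [word_eq_one_of_mem_zeros hz, mul_one]
  · rintro _ ⟨⟨z, _⟩, ⟨hz, rfl⟩, rfl⟩
    have h_eq : ∀ i < n, y i = (Iio n).piecewise y z i :=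
      fun i hi => (piecewise_eq_of_mem (Iio n) _ _ hi).symm
    refine mk_mem_cfSlice.2 ⟨_, (hK _ _ h_eq).1 hy, n, fun i hi => ?_, ?_⟩
    · exact (piecewise_eq_of_notMem (Iio n) _ _ (notMem_Iio.2 hi)).symm
    · rw [word_eq_one_of_mem_zeros hz, mul_one, word_congr c h_eq]

theorem cfSlice_mem_levelUnions {F : ℕ → Finset Γ} {K : Set (ℕ → ZMod 2)} {n : ℕ} {g : Γ}
    (hK : ∀ y z, (∀ i < n, y i = z i) → (y ∈ K ↔ z ∈ K)) (hF : ∀ y, g * word c y n ∈ F n) :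
    cfSlice c K g ∈ levelUnions F (base c) n := by
  classical
  refine ⟨{f ∈ F n | ∃ y ∈ K, g * word c y n = f}, Finset.filter_subset _ _, ?_⟩
  have h_eq : (fun y => g * word c y n) '' K = {f ∈ F n | ∃ y ∈ K, g * word c y n = f} :=
    (sep_eq_self_iff_mem_true.2 (forall_mem_image.2 fun y _ => hF y)).symm.trans
      (ext fun f => and_comm.trans Finset.mem_filter.symm)
  rw [cfSlice_eq_biUnion_smul_base hK, ← biUnion_image (g := fun f => f • base c n), h_eq]
  simp only [Finset.mem_coe]

section Measure

variable [Countable Γ]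

variable (c) in
/-- The points of `SkewProduct c` whose second coordinate comes first on its orbit, in an
enumeration of `Γ`. -/
def cfDomain : Set (SkewProduct c) :=
  orbitMinimizers TailGroup fun p => (exists_injective_nat Γ).choose p.2

theorem existsUnique_smul_mem_cfDomain [UniquelyDecodable c] (p : SkewProduct c) :
    ∃! s : TailGroup, s • p ∈ cfDomain c :=
  existsUnique_smul_mem_orbitMinimizers
    (fun _ _ h => eq_one_of_smul_snd_eq ((exists_injective_nat Γ).choose_spec h)) p

variable [MeasurableSpace Γ] [DiscreteMeasurableSpace Γ]

theorem measurableSet_cfSlice {K : Set (ℕ → ZMod 2)} (hK : MeasurableSet K) (g : Γ) :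
    MeasurableSet (cfSlice c K g) :=
  measurableSet_mk_image (measurableSet_slice hK g)

theorem measurableSet_base (n : ℕ) : MeasurableSet (base c n) :=
  measurableSet_cfSlice (isOpen_zeros n).measurableSet 1

theorem measurableSet_cfDomain : MeasurableSet (cfDomain c) :=
  measurableSet_orbitMinimizers (Measurable.of_discrete.comp measurable_snd)

variable (c) in
/-- The measure on `CFSpace c` induced by `skewMeasure c` on a fundamental domain. -/
def cfMeasure : Measure (CFSpace c) :=
  ((skewMeasure c).restrict (cfDomain c)).map (Quotient.mk _)

variable [UniquelyDecodable c]

theorem isFundamentalDomain_cfDomain :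
    IsFundamentalDomain TailGroup (cfDomain c) (skewMeasure c) :=
  .mk' measurableSet_cfDomain.nullMeasurableSet existsUnique_smul_mem_cfDomain

instance : HasFundamentalDomain TailGroup (SkewProduct c) (skewMeasure c) :=
  ⟨_, isFundamentalDomain_cfDomain⟩

instance : QuotientMeasureEqMeasurePreimage (skewMeasure c) (cfMeasure c) :=
  isFundamentalDomain_cfDomain.quotientMeasureEqMeasurePreimage_quotientMeasure

instance : StandardBorelSpace (CFSpace c) :=
  standardBorelSpace_orbitQuotient measurableSet_cfDomain existsUnique_smul_mem_cfDomain

instance : SigmaFinite (cfMeasure c) :=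
  QuotientMeasureEqMeasurePreimage.sigmaFiniteQuotient (ν := skewMeasure c) (cfMeasure c)

instance : NullSingletonClass (cfMeasure c) :=
  nullSingletonClass_of_quotient (ν := skewMeasure c) (cfMeasure c)

instance : SMulInvariantMeasure Γ (CFSpace c) (cfMeasure c) :=
  smulInvariantMeasure_of_quotient (ν := skewMeasure c) (cfMeasure c)

theorem cfMeasure_cfSlice_le {K : Set (ℕ → ZMod 2)} (hK : MeasurableSet K) (g : Γ) :
    cfMeasure c (cfSlice c K g) ≤ Measure.addHaar K :=
  (measure_mk_image_le (cfMeasure c) (measurableSet_slice hK g)).trans_eq (skewMeasure_slice K g)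

theorem cfMeasure_base_lt_top (n : ℕ) : cfMeasure c (base c n) < ⊤ :=
  (cfMeasure_cfSlice_le (isOpen_zeros n).measurableSet 1).trans_lt (measure_lt_top _ _)

theorem cfMeasure_base_ne_zero (n : ℕ) : cfMeasure c (base c n) ≠ 0 := fun h => by
  have h0 := measure_eq_zero_of_mk_image (ν := skewMeasure c) (cfMeasure c)
    (measurableSet_slice (isOpen_zeros n).measurableSet 1) h
  rw [skewMeasure_slice] at h0
  exact (isOpen_zeros n).measure_ne_zero _ ⟨0, fun _ _ => rfl⟩ h0

theorem cfMeasure_univ_eq_top {z : ℕ → Γ}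
    (hz : ∀ j k y w m, z j * word c y m = z k * word c w m → j = k) : cfMeasure c univ = ⊤ := by
  have hdisj : Pairwise (Function.onFun Disjoint fun k => z k • base c 0) :=
    fun j k hjk => disjoint_smul_base fun y _ w _ m h => hjk (hz j k y w m h)
  refine top_le_iff.1 ?_
  calc ⊤ = ∑' _ : ℕ, cfMeasure c (base c 0) :=
        (ENNReal.tsum_const_eq_top_of_ne_zero (cfMeasure_base_ne_zero 0)).symm
    _ = ∑' k, cfMeasure c (z k • base c 0) := by simp only [measure_smul]
    _ = cfMeasure c (⋃ k, z k • base c 0) :=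
        (measure_iUnion hdisj fun k => (measurableSet_base 0).const_smul (z k)).symm
    _ ≤ cfMeasure c univ := measure_mono (subset_univ _)

variable {F : ℕ → Finset Γ}

theorem isApproximable_cfSlice (hF : ∀ g, ∀ᶠ n in atTop, ∀ y, g * word c y n ∈ F n)
    {K : Set (ℕ → ZMod 2)} (hK : MeasurableSet K) (g : Γ) :
    IsApproximable (cfMeasure c) (levelUnions F (base c)) (cfSlice c K g) := by
  have hdense : (Measure.addHaar (G := ℕ → ZMod 2)).MeasureDense
      (measurableCylinders fun _ : ℕ => ZMod 2) :=
    .of_generateFrom_isSetAlgebra_finite _ isSetAlgebra_measurableCylinders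
      generateFrom_measurableCylinders.symm
  refine isApproximable_of_approx fun ε hε => ?_
  obtain ⟨δ, -, hδε⟩ := ENNReal.lt_iff_exists_real_btwn.1 hε
  obtain ⟨K', hK', hlt⟩ := hdense.approx K hK (measure_ne_top _ _) δ (by simpa using hδε.1)
  have hK'm := hdense.measurable K' hK'
  refine ⟨cfSlice c K' g, isApproximable_of_eventually_mem ?_, ?_⟩
  · obtain ⟨s, S, -, rfl⟩ := (mem_measurableCylinders _).1 hK'
    filter_upwards [eventually_gt_atTop (s.sup id), hF g] with n hn hFn
    refine cfSlice_mem_levelUnions (fun y z hyz => ?_) hFn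
    rw [mem_cylinder, mem_cylinder, show s.restrict y = s.restrict z from
      funext fun i => hyz i ((Finset.le_sup (f := id) i.2).trans_lt hn)]
  · calc cfMeasure c (cfSlice c K g ∆ cfSlice c K' g) ≤ cfMeasure c (cfSlice c (K ∆ K') g) :=
          measure_mono (symmDiff_cfSlice_subset K K' g)
      _ ≤ Measure.addHaar (K ∆ K') := cfMeasure_cfSlice_le (hK.symmDiff hK'm) g
      _ ≤ ε := (hlt.trans hδε.2).le

theorem isApproximable_of_measurableSet (hF : ∀ g, ∀ᶠ n in atTop, ∀ y, g * word c y n ∈ F n)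
    {A : Set (CFSpace c)} (hA : MeasurableSet A) (hfin : cfMeasure c A ≠ ⊤) :
    IsApproximable (cfMeasure c) (levelUnions F (base c)) A := by
  let K (g : Γ) : Set (ℕ → ZMod 2) :=
    {y | Quotient.mk (orbitRel TailGroup (SkewProduct c)) (y, g) ∈ A}
  have hK (g : Γ) : MeasurableSet (K g) := measurable_quotient_mk''.comp measurable_prodMk_right hA
  have hAK : A = ⋃ g, cfSlice c (K g) g := by
    refine Subset.antisymm (fun x hx => ?_) (iUnion_subset fun g => ?_)
    · induction x using Quotient.ind with
      | _ p => exact mem_iUnion.2 ⟨p.2, p, ⟨hx, rfl⟩, rfl⟩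
    · rintro _ ⟨⟨y, _⟩, ⟨hy, rfl⟩, rfl⟩
      exact hy
  rw [hAK] at hfin ⊢
  exact .iUnion supClosed_levelUnions empty_mem_levelUnions
    (fun g => isApproximable_cfSlice hF (hK g) g) (fun g => measurableSet_cfSlice (hK g) g) hfin

theorem isRankOne_cfMeasure (hF : IsFolnerSeq F)
    (h_mem : ∀ g, ∀ᶠ n in atTop, ∀ y, g * word c y n ∈ F n)
    (h_disj : ∀ n, ∀ f ∈ F n, ∀ f' ∈ F n, ∀ y ∈ zeros n, ∀ z ∈ zeros n, ∀ m,
      f * word c y m = f' * word c z m → f = f') :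
    IsRankOne Γ (cfMeasure c) :=
  ⟨F, hF, base c, fun n => ⟨measurableSet_base n, cfMeasure_base_lt_top n⟩,
    fun n f hf f' hf' hne => disjoint_smul_base fun y hy z hz m h =>
      hne (h_disj n f hf f' hf' y hy z hz m h),
    fun _ hA hfin => exists_tendsto_of_isApproximable
      (isApproximable_of_measurableSet h_mem hA hfin.ne)⟩

end Measure

end CuttingAndStacking

section Heisenberg

/-- The integral Heisenberg matrix with entries `a`, `b` above the diagonal and `c` in the
corner. -/
def heis (a b c : ℤ) : heisenbergLattice :=
  ⟨⟨⟨!![1, (a : ℝ), c; 0, 1, b; 0, 0, 1], by simp [Matrix.det_fin_three]⟩, by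
    refine ⟨fun i => ?_, fun i j hij => ?_⟩
    · fin_cases i <;> simp
    · fin_cases i <;> fin_cases j <;> first
        | exact absurd hij (by decide)
        | simp⟩, by
    intro i j
    simp only [heisenbergMatrix]
    fin_cases i <;> fin_cases j
    exacts [⟨1, by simp⟩, ⟨a, by simp⟩, ⟨c, by simp⟩, ⟨0, by simp⟩, ⟨1, by simp⟩, ⟨b, by simp⟩,
      ⟨0, by simp⟩, ⟨0, by simp⟩, ⟨1, by simp⟩]⟩

theorem heisenbergMatrix_heis (a b c : ℤ) :
    heisenbergMatrix (heis a b c : heisenbergGroup) = !![1, (a : ℝ), c; 0, 1, b; 0, 0, 1] := rfl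

theorem heisenbergMatrix_injective : Function.Injective heisenbergMatrix :=
  fun _ _ h => Subtype.ext (Subtype.ext h)

theorem heisenbergMatrix_mul (g h : heisenbergGroup) :
    heisenbergMatrix (g * h) = heisenbergMatrix g * heisenbergMatrix h := rfl

theorem heis_mul (a b c a' b' c' : ℤ) :
    heis a b c * heis a' b' c' = heis (a + a') (b + b') (c + c' + a * b') := by
  refine Subtype.ext (heisenbergMatrix_injective ?_)
  rw [Subgroup.coe_mul, heisenbergMatrix_mul]
  simp only [heisenbergMatrix_heis]
  ext i j
  fin_cases i <;> fin_cases j <;> simp [Matrix.mul_apply, Fin.sum_univ_three] <;> ring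

theorem heis_zero : heis 0 0 0 = 1 := by
  have h : heis 0 0 0 * heis 0 0 0 = heis 0 0 0 := by simp [heis_mul]
  exact mul_eq_right.1 h

theorem heis_inj {a b c a' b' c' : ℤ} :
    heis a b c = heis a' b' c' ↔ a = a' ∧ b = b' ∧ c = c' := by
  refine ⟨fun h => ?_, by rintro ⟨rfl, rfl, rfl⟩; rfl⟩
  have h_entry (i j) : heisenbergMatrix (heis a b c : heisenbergGroup) i j =
      heisenbergMatrix (heis a' b' c' : heisenbergGroup) i j := by rw [h]
  exact ⟨by simpa [heisenbergMatrix_heis] using h_entry 0 1,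
    by simpa [heisenbergMatrix_heis] using h_entry 1 2,
    by simpa [heisenbergMatrix_heis] using h_entry 0 2⟩

theorem exists_heis_eq (γ : heisenbergLattice) : ∃ a b c, heis a b c = γ := by
  obtain ⟨a, ha⟩ := γ.2 0 1
  obtain ⟨b, hb⟩ := γ.2 1 2
  obtain ⟨c, hc⟩ := γ.2 0 2
  have h_diag (i) : heisenbergMatrix γ.1 i i = 1 := γ.1.2.1 i
  have h_lower (i j) (hij : j < i) : heisenbergMatrix γ.1 i j = 0 := γ.1.2.2 i j hij
  refine ⟨a, b, c, Subtype.ext (heisenbergMatrix_injective ?_)⟩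
  rw [heisenbergMatrix_heis]
  ext i j
  fin_cases i <;> fin_cases j <;> simp [ha, hb, hc, h_diag, h_lower]

instance : Countable heisenbergLattice :=
  Function.Surjective.countable (f := fun p : ℤ × ℤ × ℤ => heis p.1 p.2.1 p.2.2) fun γ => by
    obtain ⟨a, b, c, rfl⟩ := exists_heis_eq γ
    exact ⟨(a, b, c), rfl⟩

end Heisenberg

section Digits

open Finset

/-- The value of the first `n` digits of `d` with respect to the weights `w`. -/
def digitSum (w d : ℕ → ℤ) (n : ℕ) : ℤ := ∑ i ∈ range n, d i * w i

variable {w d : ℕ → ℤ}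

theorem digitSum_succ (w d : ℕ → ℤ) (n : ℕ) :
    digitSum w d (n + 1) = digitSum w d n + d n * w n :=
  sum_range_succ _ n

theorem digitSum_sub (w d d' : ℕ → ℤ) (n : ℕ) :
    digitSum w (d - d') n = digitSum w d n - digitSum w d' n := by
  simp only [digitSum, Pi.sub_apply, sub_mul, sum_sub_distrib]

theorem abs_digitSum_le (hw : ∀ i, 0 ≤ w i) (hd : ∀ i, |d i| ≤ 1) (n : ℕ) :
    |digitSum w d n| ≤ ∑ i ∈ range n, w i :=
  (abs_sum_le_sum_abs _ _).trans <| sum_le_sum fun i _ => by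
    rw [abs_mul, abs_of_nonneg (hw i)]
    exact mul_le_of_le_one_left (hw i) (hd i)

theorem le_abs_digitSum_succ (hw : ∀ i, 0 ≤ w i) (hd : ∀ i, |d i| ≤ 1) {k : ℕ} (hk : d k ≠ 0) :
    w k - ∑ i ∈ range k, w i ≤ |digitSum w d (k + 1)| := by
  have h_lower := abs_digitSum_le hw hd k
  have h_top : w k ≤ |d k * w k| := by
    rw [abs_mul, abs_of_nonneg (hw k)]
    exact le_mul_of_one_le_left (hw k) (Int.one_le_abs hk)
  have h_tri := abs_sub_abs_le_abs_add (d k * w k) (digitSum w d k)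
  rw [digitSum_succ, add_comm]
  exact (sub_le_sub h_top h_lower).trans h_tri

theorem forall_eq_zero_or_exists_top_digit (d : ℕ → ℤ) (n : ℕ) :
    (∀ i < n, d i = 0) ∨ ∃ k, d k ≠ 0 ∧ ∀ w, digitSum w d n = digitSum w d (k + 1) := by
  induction n with
  | zero => exact .inl fun i hi => absurd hi i.not_lt_zero
  | succ n ih =>
    by_cases hn : d n = 0
    · refine ih.imp (fun h i hi => ?_) fun ⟨k, hk, h⟩ => ⟨k, hk, fun w => ?_⟩
      · obtain hi | rfl := Nat.lt_succ_iff_lt_or_eq.1 hi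
        exacts [h i hi, hn]
      · rw [← h w, digitSum_succ, hn, zero_mul, add_zero]
    · exact .inr ⟨n, hn, fun _ => rfl⟩

/-- The terms of a binary sequence as the integers `0` and `1`. -/
def digit (y : ℕ → ZMod 2) (i : ℕ) : ℤ := (y i).val

theorem digit_nonneg (y : ℕ → ZMod 2) (i : ℕ) : 0 ≤ digit y i := Int.natCast_nonneg _

theorem digit_le_one (y : ℕ → ZMod 2) (i : ℕ) : digit y i ≤ 1 :=
  Int.ofNat_le.2 (Nat.lt_succ_iff.1 (ZMod.val_lt (y i)))

theorem abs_digit_sub_digit_le_one (y z : ℕ → ZMod 2) (i : ℕ) : |(digit y - digit z) i| ≤ 1 :=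
  abs_sub_le_of_nonneg_of_le (digit_nonneg y i) (digit_le_one y i) (digit_nonneg z i)
    (digit_le_one z i)

theorem eq_of_digit_sub_digit_eq_zero {y z : ℕ → ZMod 2} {i : ℕ} (h : (digit y - digit z) i = 0) :
    y i = z i :=
  ZMod.val_injective 2 (Int.natCast_inj.1 (sub_eq_zero.1 h))

theorem digitSum_digit_nonneg (hw : ∀ i, 0 ≤ w i) (y : ℕ → ZMod 2) (n : ℕ) :
    0 ≤ digitSum w (digit y) n :=
  sum_nonneg fun i _ => mul_nonneg (digit_nonneg y i) (hw i)

theorem digitSum_digit_le (hw : ∀ i, 0 ≤ w i) (y : ℕ → ZMod 2) (n : ℕ) :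
    digitSum w (digit y) n ≤ ∑ i ∈ range n, w i :=
  sum_le_sum fun i _ => mul_le_of_le_one_left (hw i) (digit_le_one y i)

end Digits

section Spacer

/-- The cutting-and-stacking parameters: the elements `(8 ^ i, 2 ^ i, 0)` of `H₃(ℤ)`. -/
def spacer (i : ℕ) : heisenbergLattice := heis (8 ^ i) (2 ^ i) 0

/-- The number with `n` octal digits, all equal to `1`. -/
def repunit (n : ℕ) : ℤ := ∑ i ∈ Finset.range n, 8 ^ i

theorem seven_mul_repunit (n : ℕ) : 7 * repunit n = 8 ^ n - 1 := by
  rw [repunit, ← mul_geom_sum]; norm_num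

theorem repunit_mono : Monotone repunit := fun _ _ h =>
  Finset.sum_le_sum_of_subset_of_nonneg (Finset.range_mono h) fun _ _ _ => by positivity

theorem le_repunit (n : ℕ) : (n : ℤ) ≤ repunit n := by
  calc (n : ℤ) = ∑ _i ∈ Finset.range n, 1 := by simp
    _ ≤ repunit n := Finset.sum_le_sum fun _ _ => one_le_pow₀ (by norm_num)

theorem sum_two_pow_le_repunit (n : ℕ) : ∑ i ∈ Finset.range n, (2 : ℤ) ^ i ≤ repunit n :=
  Finset.sum_le_sum fun i _ => pow_le_pow_left₀ (by norm_num) (by norm_num) i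

theorem spacer_pow_val (y : ℕ → ZMod 2) (i : ℕ) :
    spacer i ^ (y i).val = heis (digit y i * 8 ^ i) (digit y i * 2 ^ i) 0 := by
  obtain h | h : (y i).val = 0 ∨ (y i).val = 1 := by have := ZMod.val_lt (y i); lia
  all_goals simp [digit, h, spacer, heis_zero]

theorem exists_word_spacer_eq (y : ℕ → ZMod 2) (n : ℕ) :
    ∃ e, 0 ≤ e ∧ e ≤ repunit n ^ 2 ∧
      word spacer y n = heis (digitSum (8 ^ ·) (digit y) n) (digitSum (2 ^ ·) (digit y) n) e := by
  have h2 (i : ℕ) : (0 : ℤ) ≤ 2 ^ i := by positivity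
  have h8 (i : ℕ) : (0 : ℤ) ≤ 8 ^ i := by positivity
  induction n with
  | zero => exact ⟨0, le_rfl, by simp [repunit], heis_zero.symm⟩
  | succ n ih =>
    obtain ⟨e, h0, h_le, h_eq⟩ := ih
    have hu0 := digitSum_digit_nonneg h8 y n
    have hu : digitSum (8 ^ ·) (digit y) n ≤ repunit n := digitSum_digit_le h8 y n
    have hv0 : 0 ≤ digit y n * 2 ^ n := mul_nonneg (digit_nonneg y n) (h2 n)
    have hv : digit y n * 2 ^ n ≤ 8 ^ n :=
      (mul_le_of_le_one_left (h2 n) (digit_le_one y n)).trans (by gcongr; norm_num)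
    have h_prod := mul_le_mul hu hv hv0 (hu0.trans hu)
    refine ⟨_, add_nonneg (add_nonneg h0 le_rfl) (mul_nonneg hu0 hv0), ?_,
      by rw [word, h_eq, spacer_pow_val, heis_mul, digitSum_succ, digitSum_succ]⟩
    rw [repunit, Finset.sum_range_succ, ← repunit]
    nlinarith [h8 n]

theorem word_eq_and_eq_or_exists {a b e a' b' e' : ℤ} {y z : ℕ → ZMod 2} {n m : ℕ}
    (hy : y ∈ zeros n) (hz : z ∈ zeros n)
    (h : heis a b e * word spacer y m = heis a' b' e' * word spacer z m) :
    ((∀ i < m, y i = z i) ∧ heis a b e = heis a' b' e') ∨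
      ∃ k ≥ n, 1 ≤ |b - b'| ∧ |b - b'| < 2 ^ (k + 1) ∧ 6 * repunit k < |a - a'| := by
  have h8 (i : ℕ) : (0 : ℤ) ≤ 8 ^ i := by positivity
  have h2 (i : ℕ) : (0 : ℤ) ≤ 2 ^ i := by positivity
  have hd := abs_digit_sub_digit_le_one z y
  obtain h0 | ⟨k, hk, h_top⟩ := forall_eq_zero_or_exists_top_digit (digit z - digit y) m
  · have hyz (i) (hi : i < m) : y i = z i := (eq_of_digit_sub_digit_eq_zero (h0 i hi)).symm
    exact .inl ⟨hyz, mul_right_cancel (word_congr spacer hyz ▸ h)⟩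
  · have hnk : n ≤ k := le_of_not_gt fun hkn => hk (by simp [digit, hy k hkn, hz k hkn])
    obtain ⟨u, -, -, hu⟩ := exists_word_spacer_eq y m
    obtain ⟨v, -, -, hv⟩ := exists_word_spacer_eq z m
    rw [hu, hv, heis_mul, heis_mul, heis_inj] at h
    obtain ⟨ha, hb, -⟩ := h
    have ha' : a - a' = digitSum (8 ^ ·) (digit z - digit y) (k + 1) := by
      rw [← h_top, digitSum_sub]; linarith
    have hb' : b - b' = digitSum (2 ^ ·) (digit z - digit y) (k + 1) := by
      rw [← h_top, digitSum_sub]; linarith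
    have h_geom (j : ℕ) : ∑ i ∈ Finset.range j, (2 : ℤ) ^ i = 2 ^ j - 1 := by
      rw [← mul_geom_sum, sub_eq_of_eq_add one_add_one_eq_two.symm, one_mul]
    refine .inr ⟨k, hnk, ?_, ?_, ?_⟩
    · rw [hb']
      linarith [le_abs_digitSum_succ h2 hd hk, h_geom k]
    · rw [hb']
      linarith [abs_digitSum_le h2 hd (k + 1), h_geom (k + 1)]
    · rw [ha']
      have := le_abs_digitSum_succ h8 hd hk
      linarith [seven_mul_repunit k, repunit.eq_1 k]

instance : UniquelyDecodable spacer where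
  eq_of_word_eq {y z n} h i hi := by
    obtain ⟨h_eq, -⟩ | ⟨k, -, hk, -⟩ := word_eq_and_eq_or_exists (mem_zeros_zero y)
      (mem_zeros_zero z) (congrArg (heis 0 0 0 * ·) h)
    · exact h_eq i hi
    · simp at hk

theorem central_eq_of_mul_word_eq {j k : ℕ} {y z : ℕ → ZMod 2} {m : ℕ}
    (h : heis 0 0 j * word spacer y m = heis 0 0 k * word spacer z m) : j = k := by
  obtain ⟨-, h_eq⟩ | ⟨l, -, hl, -⟩ := word_eq_and_eq_or_exists (mem_zeros_zero y)
    (mem_zeros_zero z) h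
  · exact Int.natCast_inj.1 (heis_inj.1 h_eq).2.2
  · simp at hl

end Spacer

section Folner

theorem ncard_smul_symmDiff_le {Γ : Type*} [Group Γ] {F I : Finset Γ} {γ : Γ} (hI : I ⊆ F)
    (hγ : ∀ g ∈ I, γ * g ∈ F) :
    (((γ • (F : Set Γ)) ∆ F).ncard : ℝ) ≤ 2 * (F.card - I.card) := by
  classical
  have h_left : γ • I ⊆ γ • F := Finset.smul_finset_subset_smul_finset hI
  have h_right : γ • I ⊆ F := Finset.forall_mem_image.2 hγ
  have h_card := Finset.card_union_le ((γ • F) \ (γ • I)) (F \ (γ • I))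
  rw [Finset.card_sdiff_of_subset h_left, Finset.card_sdiff_of_subset h_right,
    Finset.card_smul_finset, Finset.card_smul_finset] at h_card
  have h_sub : (γ • F) ∆ F ⊆ (γ • F) \ (γ • I) ∪ F \ (γ • I) :=
    Finset.union_subset_union (Finset.sdiff_subset_sdiff le_rfl h_right)
      (Finset.sdiff_subset_sdiff le_rfl h_left)
  rw [← Finset.coe_smul_finset, ← Finset.coe_symmDiff, ncard_coe_finset, ← Nat.cast_sub
    (Finset.card_le_card hI), two_mul]
  exact_mod_cast (Finset.card_le_card h_sub).trans h_card

theorem isFolnerSeq_of_tendsto_card_div {Γ : Type*} [Group Γ] {F : ℕ → Finset Γ}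
    (h_nonempty : ∀ n, (F n).Nonempty)
    (h : ∀ γ, ∃ I : ℕ → Finset Γ, (∀ᶠ n in atTop, I n ⊆ F n ∧ ∀ g ∈ I n, γ * g ∈ F n) ∧
      Tendsto (fun n => ((I n).card / (F n).card : ℝ)) atTop (𝓝 1)) :
    IsFolnerSeq F := by
  refine ⟨h_nonempty, fun γ => ?_⟩
  obtain ⟨I, hI, h_lim⟩ := h γ
  have h_bound : Tendsto (fun n => 2 * (1 - ((I n).card / (F n).card : ℝ))) atTop (𝓝 0) := by
    simpa using (h_lim.const_sub 1).const_mul 2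
  refine squeeze_zero' (.of_forall fun n => by positivity) (hI.mono fun n ⟨h_sub, h_mul⟩ => ?_)
    h_bound
  have h_pos : (0 : ℝ) < (F n).card := Nat.cast_pos.2 (h_nonempty n).card_pos
  rw [div_le_iff₀ h_pos, mul_assoc, sub_mul, div_mul_cancel₀ _ h_pos.ne', one_mul]
  exact ncard_smul_symmDiff_le h_sub h_mul

/-- The box of all `(a, b, c)` in `H₃(ℤ)` with `|a|, |b| ≤ r` and `|c| ≤ q`. -/
def box (r q : ℤ) : Finset heisenbergLattice :=
  (Finset.Icc (-r) r ×ˢ Finset.Icc (-r) r ×ˢ Finset.Icc (-q) q).map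
    ⟨fun p => heis p.1 p.2.1 p.2.2, fun p p' h => by
      obtain ⟨h1, h2, h3⟩ := heis_inj.1 h
      exact Prod.ext h1 (Prod.ext h2 h3)⟩

theorem heis_mem_box {a b c r q : ℤ} : heis a b c ∈ box r q ↔ |a| ≤ r ∧ |b| ≤ r ∧ |c| ≤ q := by
  simp only [box, Finset.mem_map, Finset.mem_product, Finset.mem_Icc, abs_le]
  constructor
  · rintro ⟨⟨a', b', c'⟩, h, h_eq⟩
    obtain ⟨rfl, rfl, rfl⟩ := heis_inj.1 h_eq
    exact h
  · exact fun h => ⟨(a, b, c), h, rfl⟩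

theorem box_subset_box {r r' q q' : ℤ} (hr : r ≤ r') (hq : q ≤ q') : box r q ⊆ box r' q' :=
  Finset.map_subset_map.2 <| Finset.product_subset_product
    (Finset.Icc_subset_Icc (neg_le_neg hr) hr) <| Finset.product_subset_product
      (Finset.Icc_subset_Icc (neg_le_neg hr) hr) (Finset.Icc_subset_Icc (neg_le_neg hq) hq)

theorem card_box {r q : ℤ} (hr : 0 ≤ r) (hq : 0 ≤ q) :
    ((box r q).card : ℝ) = (2 * r + 1) ^ 2 * (2 * q + 1) := by
  have h : ((box r q).card : ℤ) = (2 * r + 1) ^ 2 * (2 * q + 1) := by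
    rw [box, Finset.card_map, Finset.card_product, Finset.card_product, Int.card_Icc, Int.card_Icc]
    push_cast
    rw [Int.toNat_of_nonneg (by linarith), Int.toNat_of_nonneg (by linarith)]
    ring
  exact_mod_cast h

theorem heis_mul_mem_box {a b c k r q : ℤ} (hk : |a| + |b| + |c| ≤ k) {g : heisenbergLattice}
    (hg : g ∈ box (r - k) (q - k * (r + 1))) : heis a b c * g ∈ box r q := by
  obtain ⟨a', b', c', rfl⟩ := exists_heis_eq g
  obtain ⟨ha', hb', hc'⟩ := heis_mem_box.1 hg
  have ha := abs_nonneg a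
  have hb := abs_nonneg b
  have hc := abs_nonneg c
  rw [heis_mul, heis_mem_box]
  refine ⟨(abs_add_le a a').trans (by linarith), (abs_add_le b b').trans (by linarith), ?_⟩
  have h_prod : |a| * |b'| ≤ k * r :=
    mul_le_mul (by linarith) (by linarith) (abs_nonneg b') (by linarith)
  have h_tri := abs_add_three c c' (a * b')
  rw [abs_mul] at h_tri
  linarith

theorem card_box_div_card_box {k r : ℤ} (hk : 0 ≤ k) (hkr : k ≤ r) :
    ((box (r - k) (2 * r * (r + 1) - k * (2 * r + 1))).card / (box r (2 * r * (r + 1))).card : ℝ) =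
      (1 - 2 * k / (2 * r + 1)) ^ 3 := by
  have hr : 0 ≤ r := hk.trans hkr
  -- With `ℓ = 2 * r + 1`, the boxes have `ℓ * (ℓ - 2 * k) ^ 3` and `ℓ ^ 4` elements.
  have h_side : 2 * (2 * r * (r + 1)) + 1 = ((2 * r + 1) ^ 2 : ℝ) := by ring
  rw [card_box (sub_nonneg.2 hkr) (by nlinarith), card_box hr (by positivity)]
  push_cast
  rw [h_side]
  field_simp
  ring

theorem isFolnerSeq_box {r : ℕ → ℤ} (hr : Tendsto r atTop atTop) (hr0 : ∀ n, 0 ≤ r n) :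
    IsFolnerSeq fun n => box (r n) (2 * r n * (r n + 1)) := by
  have hq0 (n) : 0 ≤ 2 * r n * (r n + 1) := by have := hr0 n; positivity
  refine isFolnerSeq_of_tendsto_card_div (fun n => ⟨heis 0 0 0, ?_⟩) fun γ => ?_
  · simpa only [heis_mem_box, abs_zero] using ⟨hr0 n, hr0 n, hq0 n⟩
  obtain ⟨a, b, c, rfl⟩ := exists_heis_eq γ
  obtain ⟨k, hk⟩ : ∃ k, k = |a| + |b| + |c| := ⟨_, rfl⟩
  have hk0 : 0 ≤ k := hk ▸ by positivity
  refine ⟨fun n => box (r n - k) (2 * r n * (r n + 1) - k * (2 * r n + 1)),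
    .of_forall fun n => ⟨box_subset_box (by linarith) ?_, fun g hg => ?_⟩, ?_⟩
  · have : 0 ≤ k * (2 * r n + 1) := mul_nonneg hk0 (by linarith [hr0 n])
    linarith
  · refine heis_mul_mem_box hk.ge (box_subset_box le_rfl ?_ hg)
    have := mul_nonneg hk0 (hr0 n)
    linarith
  have h_lim : Tendsto (fun n => (1 - 2 * k / (2 * r n + 1) : ℝ) ^ 3) atTop (𝓝 1) := by
    have h_side : Tendsto (fun n => (2 * r n + 1 : ℝ)) atTop atTop :=
      tendsto_atTop_add_const_right _ _
        ((tendsto_intCast_atTop_atTop.comp hr).const_mul_atTop two_pos)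
    simpa using ((h_side.const_div_atTop (2 * k : ℝ)).const_sub 1).pow 3
  exact h_lim.congr' ((hr.eventually_ge_atTop k).mono fun n hn =>
    (card_box_div_card_box hk0 hn).symm)

theorem repunit_nonneg (n : ℕ) : 0 ≤ repunit n := (Nat.cast_nonneg n).trans (le_repunit n)

theorem tendsto_repunit : Tendsto repunit atTop atTop :=
  tendsto_atTop_mono le_repunit tendsto_natCast_atTop_atTop

/-- The shape of the `n`-th tower. -/
def shape (n : ℕ) : Finset heisenbergLattice :=
  box (2 * repunit n) (2 * (2 * repunit n) * (2 * repunit n + 1))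

theorem isFolnerSeq_shape : IsFolnerSeq shape :=
  isFolnerSeq_box (tendsto_atTop_mono (fun n => by linarith [repunit_nonneg n]) tendsto_repunit)
    fun n => mul_nonneg two_pos.le (repunit_nonneg n)

theorem eventually_mul_word_mem_shape (g : heisenbergLattice) :
    ∀ᶠ n in atTop, ∀ y, g * word spacer y n ∈ shape n := by
  obtain ⟨a, b, c, rfl⟩ := exists_heis_eq g
  filter_upwards [tendsto_repunit.eventually_ge_atTop (|a| + |b| + |c|)] with n hn y
  obtain ⟨e, he0, he, h_eq⟩ := exists_word_spacer_eq y n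
  have h2 (i : ℕ) : (0 : ℤ) ≤ 2 ^ i := by positivity
  have h8 (i : ℕ) : (0 : ℤ) ≤ 8 ^ i := by positivity
  rw [h_eq]
  refine heis_mul_mem_box hn (heis_mem_box.2 ⟨?_, ?_, ?_⟩)
  · rw [abs_of_nonneg (digitSum_digit_nonneg h8 y n), two_mul, add_sub_cancel_right]
    exact digitSum_digit_le h8 y n
  · rw [abs_of_nonneg (digitSum_digit_nonneg h2 y n), two_mul, add_sub_cancel_right]
    exact (digitSum_digit_le h2 y n).trans (sum_two_pow_le_repunit n)
  · rw [abs_of_nonneg he0]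
    nlinarith [repunit_nonneg n]

theorem eq_of_mem_shape {n m : ℕ} {f f' : heisenbergLattice} (hf : f ∈ shape n)
    (hf' : f' ∈ shape n) {y z : ℕ → ZMod 2} (hy : y ∈ zeros n) (hz : z ∈ zeros n)
    (h : f * word spacer y m = f' * word spacer z m) : f = f' := by
  obtain ⟨a, b, c, rfl⟩ := exists_heis_eq f
  obtain ⟨a', b', c', rfl⟩ := exists_heis_eq f'
  obtain ⟨-, h_eq⟩ | ⟨k, hk, -, -, h_lt⟩ := word_eq_and_eq_or_exists hy hz h
  · exact h_eq
  · linarith [(heis_mem_box.1 hf).1, (heis_mem_box.1 hf').1, abs_sub a a', repunit_mono hk,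
      repunit_nonneg n]

end Folner

section Recurrence

theorem exists_forall_dist_lt_mul_inv_mem {G : Type*} [Group G] [TopologicalSpace G]
    {m : MetricSpace G} (hm : IsRightInvariantCompatible m) {U : Set G} (hU : U ∈ 𝓝 1) :
    ∃ ε > 0, ∀ g h, m.dist g h < ε → g * h⁻¹ ∈ U := by
  obtain ⟨htop, hinv⟩ := hm
  rw [← htop] at hU
  obtain ⟨ε, hε, hball⟩ := (@Metric.mem_nhds_iff _ m.toPseudoMetricSpace _ _).1 hU
  refine ⟨ε, hε, fun g h hgh => hball ?_⟩
  have h_dist : m.dist (g * h⁻¹) 1 = m.dist g h := by rw [← hinv g h h⁻¹, mul_inv_cancel]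
  exact h_dist.trans_lt hgh

theorem continuous_heisenbergMatrix_apply (i j : Fin 3) :
    Continuous fun g => heisenbergMatrix g i j :=
  (Continuous.matrix_elem continuous_subtype_val i j).comp continuous_subtype_val

theorem heisenbergMatrix_mul_zero_one (g h : heisenbergGroup) :
    heisenbergMatrix (g * h) 0 1 = heisenbergMatrix g 0 1 + heisenbergMatrix h 0 1 := by
  have hg : heisenbergMatrix g 0 0 = 1 := g.2.1 0
  have hh : heisenbergMatrix h 1 1 = 1 := h.2.1 1
  have hh' : heisenbergMatrix h 2 1 = 0 := h.2.2 2 1 (by decide)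
  simp [heisenbergMatrix_mul, Matrix.mul_apply, Fin.sum_univ_three, hg, hh, hh', add_comm]

theorem heisenbergMatrix_mul_one_two (g h : heisenbergGroup) :
    heisenbergMatrix (g * h) 1 2 = heisenbergMatrix g 1 2 + heisenbergMatrix h 1 2 := by
  have hg : heisenbergMatrix g 1 1 = 1 := g.2.1 1
  have hg' : heisenbergMatrix g 1 0 = 0 := g.2.2 1 0 (by decide)
  have hh : heisenbergMatrix h 2 2 = 1 := h.2.1 2
  simp [heisenbergMatrix_mul, Matrix.mul_apply, Fin.sum_univ_three, hg, hg', hh, add_comm]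

theorem exists_forall_dist_lt_abs_entry_sub_lt_one {m : MetricSpace heisenbergGroup}
    (hm : IsRightInvariantCompatible m) : ∃ ε > 0, ∀ g h, m.dist g h < ε →
      |heisenbergMatrix g 0 1 - heisenbergMatrix h 0 1| < 1 ∧
      |heisenbergMatrix g 1 2 - heisenbergMatrix h 1 2| < 1 := by
  have h_one (i j) (hij : i ≠ j) : heisenbergMatrix 1 i j = 0 := Matrix.one_apply_ne hij
  have h_nhds : {g | |heisenbergMatrix g 0 1| < 1 ∧ |heisenbergMatrix g 1 2| < 1} ∈ 𝓝 1 :=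
    ((isOpen_lt (continuous_heisenbergMatrix_apply 0 1).abs continuous_const).inter
      (isOpen_lt (continuous_heisenbergMatrix_apply 1 2).abs continuous_const)).mem_nhds
        (by simp [h_one])
  obtain ⟨ε, hε, h_dist⟩ := exists_forall_dist_lt_mul_inv_mem hm h_nhds
  refine ⟨ε, hε, fun g h hgh => ?_⟩
  have h_mem := h_dist g h hgh
  rw [mem_ofPred_eq, ← add_sub_cancel_right (heisenbergMatrix _ 0 1) (heisenbergMatrix h 0 1),
    ← add_sub_cancel_right (heisenbergMatrix _ 1 2) (heisenbergMatrix h 1 2),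
    ← heisenbergMatrix_mul_zero_one, ← heisenbergMatrix_mul_one_two, inv_mul_cancel_right] at h_mem
  exact h_mem

theorem exp_eq_of_mem_heisenbergLie {v : Matrix (Fin 3) (Fin 3) ℝ} (hv : v ∈ heisenbergLie) :
    NormedSpace.exp v = 1 + v + (2⁻¹ : ℝ) • v ^ 2 := by
  have hv_entry (i j) (hij : j ≤ i) : v i j = 0 := hv i j hij
  have h_cube : v ^ 3 = 0 := by
    ext i j
    fin_cases i <;> fin_cases j <;>
      simp [pow_succ, Matrix.mul_apply, Fin.sum_univ_three, hv_entry]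
  have h_sum : NormedSpace.exp v = ∑ n ∈ Finset.range 3, ((n.factorial : ℝ)⁻¹) • v ^ n := by
    rw [NormedSpace.exp_eq_tsum ℝ]
    refine tsum_eq_sum fun n hn => ?_
    rw [pow_eq_zero_of_le (not_lt.1 fun h => hn (Finset.mem_range.2 h)) h_cube, smul_zero]
  simp [h_sum, Finset.sum_range_succ]

theorem exists_entries_eq_of_mem_expLine {θ : Projectivization ℝ heisenbergLie}
    {g : heisenbergGroup} (hg : g ∈ expLine θ) :
    ∃ t : ℝ, heisenbergMatrix g 0 1 = t * θ.rep.1 0 1 ∧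
      heisenbergMatrix g 1 2 = t * θ.rep.1 1 2 := by
  obtain ⟨w, hw, h_exp⟩ := hg
  rw [Projectivization.submodule_eq, Submodule.mem_span_singleton] at hw
  obtain ⟨t, rfl⟩ := hw
  have h_entry (i j) (hij : j ≤ i) : θ.rep.1 i j = 0 := θ.rep.2 i j hij
  rw [h_exp, exp_eq_of_mem_heisenbergLie (t • θ.rep).2]
  refine ⟨t, ?_, ?_⟩ <;> simp [pow_two, Matrix.mul_apply, Fin.sum_univ_three, h_entry]

theorem exists_abs_le_mul_abs_of_near_line (α β : ℝ) :
    ∃ C : ℝ, ∀ t a b : ℝ, |a - t * α| < 1 → |b - t * β| < 1 → 1 ≤ |b| → |a| ≤ C * |b| := by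
  refine ⟨2 * |α| / |β| + 1, fun t a b ha hb hb1 => ?_⟩
  obtain rfl | hβ := eq_or_ne β 0
  · rw [mul_zero, sub_zero] at hb
    exact absurd hb hb1.not_gt
  have hβ_pos : 0 < |β| := abs_pos.2 hβ
  have ha' : |a| ≤ |t| * |α| + 1 := by
    rw [← abs_mul]
    linarith [abs_sub_abs_le_abs_sub a (t * α)]
  have ht : |t| ≤ 2 * |b| / |β| := by
    rw [le_div_iff₀ hβ_pos, ← abs_mul]
    linarith [abs_sub_abs_le_abs_sub (t * β) b, abs_sub_comm (t * β) b]
  calc |a| ≤ 2 * |b| / |β| * |α| + |b| := ha'.trans (by gcongr)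
    _ = (2 * |α| / |β| + 1) * |b| := by ring

theorem mul_abs_le_abs_of_nonempty_inter {a b c : ℤ} {n : ℕ} (h_ne : heis a b c ≠ 1)
    (h : (base spacer n ∩ heis a b c • base spacer n).Nonempty) :
    1 ≤ |b| ∧ n * |b| ≤ |a| := by
  obtain ⟨x, hx, hx'⟩ := h
  rw [← one_smul heisenbergLattice (base spacer n)] at hx
  obtain ⟨y, hy, z, hz, m, h_eq⟩ := exists_word_eq_of_mem_smul_base hx' hx
  rw [← heis_zero] at h_eq h_ne
  obtain ⟨-, h_eq⟩ | ⟨k, hnk, hb1, hb, ha⟩ := word_eq_and_eq_or_exists hy hz h_eq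
  · exact absurd h_eq h_ne
  rw [sub_zero] at hb1 hb ha
  have h_bernoulli : (1 + k * 3 : ℤ) ≤ (1 + 3) ^ k := one_add_mul_le_pow (by norm_num) k
  have h_eight : (8 : ℤ) ^ k = (1 + 3) ^ k * 2 ^ k := by rw [← mul_pow]; norm_num
  have h_pow := mul_le_mul_of_nonneg_right h_bernoulli (by positivity : (0 : ℤ) ≤ 2 ^ k)
  refine ⟨hb1, ?_⟩
  calc (n * |b| : ℤ) ≤ k * 2 ^ (k + 1) :=
        mul_le_mul (Int.ofNat_le.2 hnk) hb.le (abs_nonneg b) (Int.natCast_nonneg k)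
    _ ≤ 6 * repunit k + 1 := by
        have h_rep := seven_mul_repunit k
        have h_nonneg : (0 : ℤ) ≤ k * 2 ^ k := by positivity
        have h_one_le : (1 : ℤ) ≤ 2 ^ k := one_le_pow₀ (by norm_num)
        rw [h_eight] at h_rep
        rw [pow_succ]
        linarith
    _ ≤ |a| := ha

variable [MeasurableSpace heisenbergLattice] [DiscreteMeasurableSpace heisenbergLattice]

theorem recurrentDirections_cfMeasure_spacer {m : MetricSpace heisenbergGroup}
    (hm : IsRightInvariantCompatible m) : recurrentDirections m (cfMeasure spacer) = ∅ := by
  refine eq_empty_iff_forall_notMem.2 fun θ hθ => ?_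
  obtain ⟨ε, hε, h_dist⟩ := exists_forall_dist_lt_abs_entry_sub_lt_one hm
  obtain ⟨C, hC⟩ := exists_abs_le_mul_abs_of_near_line (θ.rep.1 0 1) (θ.rep.1 1 2)
  obtain ⟨n, hn⟩ := exists_nat_gt C
  obtain ⟨γ, hγ, ⟨g, hg, hγg⟩, h_pos⟩ := hθ ε hε (base spacer n) (measurableSet_base n)
    (pos_iff_ne_zero.2 (cfMeasure_base_ne_zero n))
  obtain ⟨a, b, c, rfl⟩ := exists_heis_eq γ
  obtain ⟨hb, hab⟩ :=
    mul_abs_le_abs_of_nonempty_inter hγ (nonempty_of_measure_ne_zero h_pos.ne')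
  obtain ⟨t, ht, ht'⟩ := exists_entries_eq_of_mem_expLine hg
  obtain ⟨ha_near, hb_near⟩ := h_dist _ _ hγg
  rw [ht] at ha_near
  rw [ht'] at hb_near
  have hb_real : (1 : ℝ) ≤ |(b : ℝ)| := by exact_mod_cast hb
  have h_upper : |(a : ℝ)| ≤ C * |(b : ℝ)| := hC t a b ha_near hb_near hb_real
  have h_lower : (n : ℝ) * |(b : ℝ)| ≤ |(a : ℝ)| := by exact_mod_cast hab
  exact (h_lower.trans h_upper).not_gt (mul_lt_mul_of_pos_right hn (one_pos.trans_le hb_real))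

end Recurrence

end

end CuttingStacking

theorem theorem6p1 :
    ∃ (X : Type) (_ : MeasurableSpace X) (_ : StandardBorelSpace X)
      (_ : MulAction heisenbergLattice X) (_ : MeasurableConstSMul heisenbergLattice X)
      (μ : MeasureTheory.Measure X),
      MeasureTheory.SigmaFinite μ ∧
      (∀ x : X, μ {x} = 0) ∧
      μ Set.univ = ⊤ ∧
      MeasureTheory.SMulInvariantMeasure heisenbergLattice X μ ∧
      (∀ (γ : heisenbergLattice) (x : X), γ • x = x → γ = 1) ∧
      IsRankOne heisenbergLattice μ ∧
      ∀ m : MetricSpace heisenbergGroup, IsRightInvariantCompatible m →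
        recurrentDirections m μ = ∅ := by
  let _ : MeasurableSpace heisenbergLattice := ⊤
  have : DiscreteMeasurableSpace heisenbergLattice := ⟨fun _ => trivial⟩
  refine ⟨CuttingStacking.CFSpace CuttingStacking.spacer, inferInstance, inferInstance,
    inferInstance, inferInstance, CuttingStacking.cfMeasure CuttingStacking.spacer, inferInstance,
    MeasureTheory.measure_singleton, ?_, inferInstance,
    fun _ _ => CuttingStacking.eq_one_of_smul_eq, ?_,
    fun _ => CuttingStacking.recurrentDirections_cfMeasure_spacer⟩
  · exact CuttingStacking.cfMeasure_univ_eq_top (z := fun k => CuttingStacking.heis 0 0 k)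
      fun _ _ _ _ _ => CuttingStacking.central_eq_of_mul_word_eq
  · exact CuttingStacking.isRankOne_cfMeasure CuttingStacking.isFolnerSeq_shape
      CuttingStacking.eventually_mul_word_mem_shape
      fun _ _ hf _ hf' _ hy _ hz _ => CuttingStacking.eq_of_mem_shape hf hf' hy hz
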